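/- **Proposition 7.4 (Chern forms positive).** Let $X$ be a complex manifold of dimension $n$ and let $E\to X$ be a holomorphic vector bundle of rank $m$ with a smooth Hermitian metric $h$, linear in its first variable. Let $D_E$ be the Chern connection of $(E,h)$, $\Theta=D_E^2$ its curvature, which is an $\mathrm{End}(E)$-valued $(1,1)$-form, and let $c_k(D_E)$ be the $k$-th Chern form, i.e. the component of degree $2k$ of $c(D_E)=\det\big(\tfrac{i}{2\pi}\Theta+I\big)$. In a local orthonormal frame $e_j$ with dual frame $e_j^*$ write $\Theta=\sum_{j,k}\Theta_{jk}\otimes e_j\otimes e_k^*$. One says that $E$ is Bott–Chern positive, $E\ge_B 0$, if at every point of $X$ the Hermitian form on $T^{1,0}X\otimes E^*$ given by $$a(\xi\otimes e_j^*,\eta\otimes e_k^*)=\Theta_{jk}(\xi,\bar\eta)$$ is positive semidefinite, and that $E$ is Nakano positive, $E\ge_N 0$, if at every point the Hermitian form on $T^{1,0}X\otimes E$ given by $$a'(\xi\otimes u,\eta\otimes v)=h(\Theta(\xi,\bar\eta)u,v)$$ is positive semidefinite. If $E\ge_B 0$ or $E\ge_N 0$, then for every $k\ge 0$ the Chern form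 $c_k(D_E)$ is a positive form. That is, $c_k(D_E)$ is of bidegree $(k,k)$ and, at every point of $X$, for all $(1,0)$-covectors $\alpha_1,\dots,\alpha_{n-k}$ (if $k\le n$) the $(n,n)$-form $$c_k(D_E)\wedge i\alpha_1\wedge\bar\alpha_1\wedge\dots\wedge i\alpha_{n-k}\wedge\bar\alpha_{n-k}$$ is a nonnegative multiple of $i\,dz_1\wedge d\bar z_1\wedge\dots\wedge i\,dz_n\wedge d\bar z_n$. Moreover, $c_k(D_E)$ is positive in the stronger sense that at every point it is a finite sum $\sum_\ell i^{k^2}\eta_\ell\wedge\bar\eta_\ell$ with $\eta_\ell$ of bidegree $(k,0)$. -/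

import Mathlib

open scoped ContDiff Manifold ComplexOrder

noncomputable section

/-! ### Complex-valued exterior forms at a point

`V` is a complex vector space, in the applications the tangent space of a complex manifold
at a point. -/

/-- The complexified cotangent space: the complex-valued real-linear forms on `V`. -/
abbrev Covector (V : Type*) [NormedAddCommGroup V] [NormedSpace ℂ V] : Type _ := V →L[ℝ] ℂ

/-- The algebra of complex-valued exterior forms on `V`; the product is the wedge product. -/
abbrev Forms (V : Type*) [NormedAddCommGroup V] [NormedSpace ℂ V] : Type _ :=
  ExteriorAlgebra ℂ (Covector V)

section Pointwise

variable {V : Type*} [NormedAddCommGroup V] [NormedSpace ℂ V]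

/-- A covector, seen as an exterior form of degree one. -/
def oneForm : Covector V →ₗ[ℂ] Forms V := ExteriorAlgebra.ι ℂ

/-- Multiplication by `i` on `V`, as a real-linear map. -/
def mulI (V : Type*) [NormedAddCommGroup V] [NormedSpace ℂ V] : V →L[ℝ] V :=
  (Complex.I • ContinuousLinearMap.id ℂ V).restrictScalars ℝ

/-- The `(1,0)`-part of a covector. -/
def part10 (α : Covector V) : Covector V :=
  (1 / 2 : ℂ) • (α - Complex.I • α.comp (mulI V))

/-- The complex conjugate of a covector. -/
def conjCovector (α : Covector V) : Covector V :=
  (Complex.conjCLE : ℂ →L[ℝ] ℂ).comp α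

/-- The `(1,0)`-covectors: the complex-linear ones. -/
def covectors10 (V : Type*) [NormedAddCommGroup V] [NormedSpace ℂ V] :
    Submodule ℂ (Covector V) where
  carrier := {α | ∀ v : V, α (Complex.I • v) = Complex.I * α v}
  add_mem' := by
    intro a b ha hb v
    simp only [Set.mem_ofPred_eq] at ha hb
    simp [ha v, hb v, mul_add]
  zero_mem' := by intro v; simp
  smul_mem' := by
    intro c a ha v
    simp only [Set.mem_ofPred_eq] at ha
    simp only [smul_apply, smul_eq_mul, ha v]
    ring

/-- The `(0,1)`-covectors: the conjugate-linear ones. -/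
def covectors01 (V : Type*) [NormedAddCommGroup V] [NormedSpace ℂ V] :
    Submodule ℂ (Covector V) where
  carrier := {α | ∀ v : V, α (Complex.I • v) = -(Complex.I * α v)}
  add_mem' := by
    intro a b ha hb v
    simp only [Set.mem_ofPred_eq] at ha hb
    simp only [add_apply, ha v, hb v]
    ring
  zero_mem' := by intro v; simp
  smul_mem' := by
    intro c a ha v
    simp only [Set.mem_ofPred_eq] at ha
    simp only [smul_apply, smul_eq_mul, ha v]
    ring

/-- The exterior forms of bidegree `(p,q)`: the span of the products of `p` covectors of type
`(1,0)` followed by `q` covectors of type `(0,1)`. -/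
def bidegree (V : Type*) [NormedAddCommGroup V] [NormedSpace ℂ V] (p q : ℕ) :
    Submodule ℂ (Forms V) :=
  ((covectors10 V).map oneForm) ^ p * ((covectors01 V).map oneForm) ^ q

/-! Complex conjugation of exterior forms: the conjugate-linear ring homomorphism that extends
the conjugation of covectors. It is obtained from the universal property of the exterior algebra,
the target being the algebra of forms with its conjugate complex structure. -/

/-- The ring of forms, to be endowed with the conjugate complex structure. -/
def ConjForms (V : Type*) [NormedAddCommGroup V] [NormedSpace ℂ V] : Type _ := Forms V

instance : Ring (ConjForms V) := inferInstanceAs (Ring (Forms V))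

instance : Algebra ℂ (ConjForms V) :=
  ((algebraMap ℂ (Forms V)).comp (starRingEnd ℂ)).toAlgebra' (fun c x =>
    Algebra.commutes (A := Forms V) ((starRingEnd ℂ) c) x)

/-- `α ↦ conj α`, as a complex-linear map into the forms with conjugate complex structure. -/
def conjLift : Covector V →ₗ[ℂ] ConjForms V where
  toFun α := (oneForm (conjCovector α) : Forms V)
  map_add' := by
    intro a b
    have h : conjCovector (a + b) = conjCovector a + conjCovector b := by
      ext v; simp [conjCovector]
    change (oneForm (conjCovector (a + b)) : Forms V)
      = (oneForm (conjCovector a) : Forms V) + oneForm (conjCovector b)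
    rw [h, map_add]
  map_smul' := by
    intro c a
    have h : conjCovector (c • a) = (starRingEnd ℂ) c • conjCovector a := by
      ext v; simp [conjCovector]
    change (oneForm (conjCovector (c • a)) : Forms V)
      = algebraMap ℂ (Forms V) ((starRingEnd ℂ) c) * oneForm (conjCovector a)
    rw [h, map_smul]
    exact Algebra.smul_def (A := Forms V) _ _

/-- Complex conjugation of exterior forms. -/
def conjForm : Forms V →+* Forms V :=
  ((ExteriorAlgebra.lift ℂ ⟨conjLift (V := V), fun α =>
    ExteriorAlgebra.ι_sq_zero (R := ℂ) (conjCovector α)⟩ :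
      Forms V →ₐ[ℂ] ConjForms V) : Forms V →+* ConjForms V)

/-- A form of degree `2k` is a *sum of squares* if it is a finite sum of forms
`i^(k^2) η ∧ conj η`, with `η` of bidegree `(k,0)`. -/
def IsSumOfSquaresForm (k : ℕ) (u : Forms V) : Prop :=
  ∃ (N : ℕ) (η : Fin N → Forms V), (∀ l, η l ∈ bidegree V k 0) ∧
    u = ∑ l, (Complex.I ^ (k ^ 2)) • (η l * conjForm (η l))

/-- The product `i α₁ ∧ conj α₁ ∧ ... ∧ i α_q ∧ conj α_q`. -/
def elementaryForm {q : ℕ} (α : Fin q → Covector V) : Forms V :=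
  (List.ofFn fun t => Complex.I • (oneForm (α t) * oneForm (conjCovector (α t)))).prod

/-- The positive forms of top bidegree `(n,n)`, `n = dim V`: the nonnegative multiples of
`i dz₁ ∧ d(conj z₁) ∧ ... ∧ i dz_n ∧ d(conj z_n)`, for complex-linear `z₁, ..., z_n`. -/
def IsPositiveTopForm (w : Forms V) : Prop :=
  ∃ (c : ℝ) (β : Fin (Module.finrank ℂ V) → Covector V),
    0 ≤ c ∧ (∀ s, β s ∈ covectors10 V) ∧ w = (c : ℂ) • elementaryForm β

/-- *Positive* forms of bidegree `(k,k)` on an `n`-dimensional space (in the sense of Lelong):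
the exterior product with every `i α₁ ∧ conj α₁ ∧ ... ∧ i α_{n-k} ∧ conj α_{n-k}`,
`α_t` of type `(1,0)`, is a positive form of top bidegree. -/
def IsPositiveForm (k : ℕ) (u : Forms V) : Prop :=
  u ∈ bidegree V k k ∧
  ∀ (q : ℕ) (α : Fin q → Covector V), k + q = Module.finrank ℂ V →
    (∀ t, α t ∈ covectors10 V) → IsPositiveTopForm (u * elementaryForm α)

/-! Complex tangent vectors act on complex covectors: for `v` in `V`, the `(1,0)`-vector
`v^(1,0) = (v - i Jv)/2` and its conjugate `(v + i Jv)/2`, `J` the complex structure. Every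
`(1,0)`-vector is `v^(1,0)` for exactly one `v`. -/

/-- The `(1,0)`-vector of `v`, as a linear functional on complex covectors. -/
def vec10 (v : V) : Module.Dual ℂ (Covector V) where
  toFun α := (α v - Complex.I * α (Complex.I • v)) / 2
  map_add' := by intro a b; simp only [add_apply]; ring
  map_smul' := by
    intro c a
    simp only [smul_apply, smul_eq_mul, RingHom.id_apply]; ring

/-- The `(0,1)`-vector conjugate to `vec10 v`. -/
def vec01 (v : V) : Module.Dual ℂ (Covector V) where
  toFun α := (α v + Complex.I * α (Complex.I • v)) / 2
  map_add' := by intro a b; simp only [add_apply]; ring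
  map_smul' := by
    intro c a
    simp only [smul_apply, smul_eq_mul, RingHom.id_apply]; ring

/-- The value `u(ξ, conj η)` of (the degree two part of) a form `u`, for the `(1,0)`-vectors
`ξ`, `η` of `v`, `w`: contract first with `ξ`, then with `conj η`. In particular
`(α ∧ β)(ξ, conj η) = α(ξ) β(conj η) - α(conj η) β(ξ)`. -/
def evalForm (u : Forms V) (v w : V) : ℂ :=
  ExteriorAlgebra.algebraMapInv
    (CliffordAlgebra.contractLeft (vec01 w) (CliffordAlgebra.contractLeft (vec10 v) u))

end Pointwise

/-! ### Exterior derivative on open subsets of `V` -/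

section Calculus

variable {V : Type*} [NormedAddCommGroup V] [NormedSpace ℂ V]

/-- `∂g` at `z`, for a function `g`: the `(1,0)`-part of `dg`. -/
def delFun (g : V → ℂ) (z : V) : Covector V := part10 (fderiv ℝ g z)

/-- The exterior derivative `dθ = ∑ dxᵢ ∧ ∂θ/∂xᵢ` at `z` of a one-form `θ`, in the linear
coordinates `xᵢ` of a real basis of `V` (the choice of which is immaterial). -/
def extDerivOneForm [FiniteDimensional ℂ V] (θ : V → Covector V) (z : V) : Forms V :=
  ∑ i, oneForm (Complex.ofRealCLM.comp
      (LinearMap.toContinuousLinearMap ((Module.finBasis ℝ V).coord i)))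
    * oneForm (fderiv ℝ θ z (Module.finBasis ℝ V i))

end Calculus

/-! ### Hermitian holomorphic vector bundles and their Chern forms

`X` is a complex manifold modelled on the finite dimensional space `V`, and `E` is a holomorphic
vector bundle of rank `m` over `X`. -/

/-- A smooth Hermitian metric on a holomorphic vector bundle: a Hermitian inner product on every
fibre (conjugate-linear in the first, linear in the second variable) whose coefficients in the
local holomorphic frames are smooth functions. -/
structure HermitianMetric (V : Type*) [NormedAddCommGroup V] [NormedSpace ℂ V]
    {X : Type*} [TopologicalSpace X] [ChartedSpace V X]
    (m : ℕ) (E : X → Type*) [TopologicalSpace (Bundle.TotalSpace (Fin m → ℂ) E)]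
    [∀ x, AddCommGroup (E x)] [∀ x, Module ℂ (E x)] [∀ x, TopologicalSpace (E x)]
    [FiberBundle (Fin m → ℂ) E] where
  inner : ∀ x, E x →ₗ⋆[ℂ] E x →ₗ[ℂ] ℂ
  conj_symm : ∀ x (u v : E x), (starRingEnd ℂ) (inner x u v) = inner x v u
  pos : ∀ x (u : E x), u ≠ 0 → 0 < inner x u u
  smooth : ∀ (e : Bundle.Trivialization (Fin m → ℂ) (Bundle.TotalSpace.proj :
      Bundle.TotalSpace (Fin m → ℂ) E → X)) [MemTrivializationAtlas e] (a b : Fin m → ℂ),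
    ContMDiffOn 𝓘(ℝ, V) 𝓘(ℝ, ℂ) ∞ (fun x => inner x (e.symm x a) (e.symm x b)) e.baseSet

namespace HermitianMetric

variable {V : Type*} [NormedAddCommGroup V] [NormedSpace ℂ V]
  {X : Type*} [TopologicalSpace X] [ChartedSpace V X]
  {m : ℕ} {E : X → Type*} [TopologicalSpace (Bundle.TotalSpace (Fin m → ℂ) E)]
  [∀ x, AddCommGroup (E x)] [∀ x, Module ℂ (E x)] [∀ x, TopologicalSpace (E x)]
  [FiberBundle (Fin m → ℂ) E]

/-- The Gram matrix `G_{jk} = h(e_j, e_k)` of the metric in the holomorphic frame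
`e_1, ..., e_m` given by the trivialization at `x₀`, as a function in the chart at `x₀`. -/
def gram (h : HermitianMetric V m E) (x₀ : X) (z : V) : Matrix (Fin m) (Fin m) ℂ :=
  let y := (chartAt V x₀).symm z
  let e := trivializationAt (Fin m → ℂ) E x₀
  Matrix.of fun j k => h.inner y (e.symm y (Pi.single j 1)) (e.symm y (Pi.single k 1))

/-- The connection matrix `θ = G⁻¹ ∂G` of the Chern connection `D` in the same holomorphic frame
and chart: `D e_k = ∑_j θ_{jk} e_j`. It is of type `(1,0)`, so that the `(0,1)`-part of `D` is
`∂bar`, and `D` is compatible with the metric; these two properties characterize it. -/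
def connectionMatrix (h : HermitianMetric V m E) (x₀ : X) (j k : Fin m) (z : V) : Covector V :=
  ∑ l, (h.gram x₀ z)⁻¹ j l • delFun (fun y => h.gram x₀ y l k) z

/-- The matrix of the curvature `Θ = D²` of the Chern connection at the point `x`:
`Θ = dθ + θ ∧ θ` (so that `Θ e_k = ∑_j Θ_{jk} e_j`), in the holomorphic frame at `x`. The entries
are forms on the tangent space of `X` at `x`, which is `V` by means of the chart at `x`. -/
def curvature [FiniteDimensional ℂ V] (h : HermitianMetric V m E) (x : X) :
    Matrix (Fin m) (Fin m) (Forms V) :=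
  Matrix.of fun j k =>
    extDerivOneForm (h.connectionMatrix x j k) (chartAt V x x)
      + ∑ l, oneForm (h.connectionMatrix x j l (chartAt V x x))
          * oneForm (h.connectionMatrix x l k (chartAt V x x))

/-- The total Chern form `c(D) = det((i/2π) Θ + I)` at `x`, by the Leibniz formula. (The entries
are of even degree, hence commute, so that the order of the factors is immaterial.) -/
def totalChernForm [FiniteDimensional ℂ V] (h : HermitianMetric V m E) (x : X) : Forms V :=
  ∑ σ : Equiv.Perm (Fin m), (Equiv.Perm.sign σ : ℤ) •
    (List.ofFn fun j =>
      ((Complex.I / (2 * (Real.pi : ℂ))) • h.curvature x + 1) (σ j) j).prod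

/-- The `k`-th Chern form `c_k(D)` at `x`: the component of degree `2k` of `c(D)`. -/
def chernForm [FiniteDimensional ℂ V] (h : HermitianMetric V m E) (k : ℕ) (x : X) : Forms V :=
  (DirectSum.decompose (fun i : ℕ => ⋀[ℂ]^i (Covector V)) (h.totalChernForm x) (2 * k) :)

/-- The complex number `h(a, Θ(ξ, conj η) b)` for the vectors of `E x` with coordinates `a`, `b`
in the frame at `x`, and the `(1,0)`-vectors `ξ`, `η` of the tangent vectors `v`, `w`. -/
def curvaturePairing [FiniteDimensional ℂ V] (h : HermitianMetric V m E) (x : X)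
    (v w : V) (a b : Fin m → ℂ) : ℂ :=
  star a ⬝ᵥ (h.gram x (chartAt V x x)).mulVec
    (((h.curvature x).map fun u => evalForm u v w).mulVec b)

/-- *Bott-Chern positivity*, `E ≥_B 0`: at every point the form
`(ξ ⊗ φ, η ⊗ ψ) ↦ φ(Θ(ξ, conj η) ψ^♯)` on `T^{1,0} ⊗ E^*` is positive semidefinite. Here `ψ^♯`
is the vector with `ψ = h(ψ^♯, ·)`. A tensor is written as `∑ ξ_s ⊗ h(a_s, ·)`. -/
def IsBottChernPositive [FiniteDimensional ℂ V] (h : HermitianMetric V m E) : Prop :=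
  ∀ (x : X) (N : ℕ) (v : Fin N → V) (a : Fin N → Fin m → ℂ),
    0 ≤ ∑ s, ∑ t, h.curvaturePairing x (v s) (v t) (a s) (a t)

/-- *Nakano positivity*, `E ≥_N 0`: at every point the form
`(ξ ⊗ a, η ⊗ b) ↦ h(b, Θ(ξ, conj η) a)` on `T^{1,0} ⊗ E` is positive semidefinite.
A tensor is written as `∑ ξ_s ⊗ a_s`. -/
def IsNakanoPositive [FiniteDimensional ℂ V] (h : HermitianMetric V m E) : Prop :=
  ∀ (x : X) (N : ℕ) (v : Fin N → V) (a : Fin N → Fin m → ℂ),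
    0 ≤ ∑ s, ∑ t, h.curvaturePairing x (v s) (v t) (a t) (a s)

end HermitianMetric

end

/-! Let G be the Gram matrix of h in the holomorphic frame at a point, θ = G⁻¹∂G, and let A = GΘ be
the curvature with its first index lowered, so that A_jk = h(e_j, Θ e_k). Differentiating Gθ = ∂G
gives A = ∂̄∂G − ∂̄G ∧ θ, so the entries of A have type (1,1) (`sum_gram_smul_curvature_mem`). Every
tensor in T ⊗ ℂ^m is some ∑ v_s ⊗ e_s; hence Bott–Chern positivity makes the coefficient matrix of A
positive semidefinite, and Nakano positivity does the same for Aᵀ. A positive semidefinite matrix is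
a sum of rank-one squares, so A or Aᵀ has entries ∑_r β_ri ∧ conj β_rj with β_ri of type (1,0)
(`exists_eq_sum_mul_conj`).

The frame need not be orthonormal, so Θ = G⁻¹A. Writing G⁻¹ = PPᴴ, one has det(1 + cPPᴴA) = det(1 +
cPᴴAP), and PᴴAP has the same shape as A. Transposition does not change the determinant, so the two
notions of positivity lead to the same computation.

The component of degree 2k of det(1 + cM) is the sum of the principal k × k minors of cM. In such a
minor put H(r) = β_{r(1),1} ∧ … ∧ β_{r(k),k}. Reordering the wedge product produces the sign of σ,
which cancels the sign in the determinant; up to a positive constant there remains i^(k²) ∑_σ ∑_r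
H(r∘σ⁻¹) ∧ conj H(r). Averaging over the symmetric group turns this into a sum of squares of the
symmetrizations ∑_σ H(r∘σ) (`isSumOfSquaresForm_det`).

Sums of squares are positive in the sense of Lelong, because a square times an elementary form is
the square of an (n,0)-form, and these forms make up a line (`IsSumOfSquaresForm.isPositiveForm`).
-/

noncomputable section

/-! ### Graded commutativity and top powers in the exterior algebra -/

namespace ExteriorAlgebra

variable {R M : Type*} [CommRing R] [AddCommGroup M] [Module R M]

theorem ι_mul_of_mem_exteriorPower (y : M) {n : ℕ} {x : ExteriorAlgebra R M}
    (hx : x ∈ ⋀[R]^n M) : ι R y * x = (-1 : R) ^ n • (x * ι R y) := by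
  induction hx using Submodule.pow_induction_on_left' with
  | algebraMap r => simp [Algebra.commutes]
  | add a b i _ _ ha hb => rw [mul_add, ha, hb, add_mul, smul_add]
  | mem_mul a ha i x _ ih =>
    obtain ⟨z, rfl⟩ := ha
    have h : ι R y * ι R z = -(ι R z * ι R y) := eq_neg_of_add_eq_zero_left (ι_add_mul_swap y z)
    rw [← mul_assoc, h, neg_mul, mul_assoc, ih, mul_smul_comm, pow_succ, mul_assoc]
    simp

theorem mul_comm_of_mem_exteriorPower {p q : ℕ} {x y : ExteriorAlgebra R M}
    (hx : x ∈ ⋀[R]^p M) (hy : y ∈ ⋀[R]^q M) : x * y = (-1 : R) ^ (p * q) • (y * x) := by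
  induction hx using Submodule.pow_induction_on_left' with
  | algebraMap r => simp [Algebra.commutes]
  | add a b i _ _ ha hb => rw [mul_add, add_mul, ha, hb, smul_add]
  | mem_mul a ha i x _ ih =>
    obtain ⟨z, rfl⟩ := ha
    rw [mul_assoc, ih, mul_smul_comm, ← mul_assoc, ι_mul_of_mem_exteriorPower z hy,
      smul_mul_assoc, smul_smul, ← pow_add, mul_assoc, Nat.succ_mul]

theorem ιMulti_mem_exteriorPower {n : ℕ} (v : Fin n → M) : ιMulti R n v ∈ ⋀[R]^n M :=
  ιMulti_range R n ⟨v, rfl⟩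

theorem ιMulti_mem_map_pow {n : ℕ} (S : Submodule R M) {v : Fin n → M} (hv : ∀ t, v t ∈ S) :
    ιMulti R n v ∈ (S.map (ι R)) ^ n := by
  induction n with
  | zero => simp
  | succ n ih =>
    rw [ιMulti_succ_apply, pow_succ']
    exact Submodule.mul_mem_mul (Submodule.mem_map_of_mem (hv 0)) (ih fun t => hv t.succ)

theorem map_ι_pow_le (S : Submodule R M) (n : ℕ) : (S.map (ι R)) ^ n ≤ ⋀[R]^n M :=
  pow_le_pow_left' (LinearMap.map_le_range) n

/-- The `n`-th power of a submodule spanned by `e 1, ..., e n` is spanned by the product of the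
`e i`. -/
theorem exists_eq_smul_ιMulti {n : ℕ} (S : Submodule R M) (e : Fin n → M)
    (hS : S ≤ Submodule.span R (Set.range e)) {x : ExteriorAlgebra R M}
    (hx : x ∈ (S.map (ι R)) ^ n) : ∃ c : R, x = c • ιMulti R n e := by
  have key : ∀ (k : ℕ) (x : ExteriorAlgebra R M), x ∈ (S.map (ι R)) ^ k →
      x ∈ Submodule.span R {y | ∃ v : Fin k → M, (∀ t, v t ∈ S) ∧ y = ιMulti R k v} := by
    intro k x hx
    induction hx using Submodule.pow_induction_on_left' with
    | algebraMap r =>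
      rw [Algebra.algebraMap_eq_smul_one]
      exact Submodule.smul_mem _ _ (Submodule.subset_span ⟨Fin.elim0, fun t => t.elim0, by simp⟩)
    | add a b i _ _ ha hb => exact add_mem ha hb
    | mem_mul a ha i x _ ih =>
      obtain ⟨z, hz, rfl⟩ := ha
      rename_i hx'
      clear hx'
      induction ih using Submodule.span_induction with
      | mem y hy =>
        obtain ⟨v, hv, rfl⟩ := hy
        refine Submodule.subset_span ⟨Fin.cons z v, ?_, ?_⟩
        · intro t
          refine Fin.cases ?_ ?_ t
          · exact hz
          · intro t; exact hv t
        · rw [ιMulti_succ_apply]; rfl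
      | zero => simp
      | add a b _ _ ha hb => rw [mul_add]; exact add_mem ha hb
      | smul c a _ ha => rw [mul_smul_comm]; exact Submodule.smul_mem _ _ ha
  have hx' := key n x hx
  clear hx
  induction hx' using Submodule.span_induction with
  | mem y hy =>
    obtain ⟨v, hv, rfl⟩ := hy
    have hv' : ∀ t, ∃ c : Fin n → R, ∑ i, c i • e i = v t := fun t =>
      (Submodule.mem_span_range_iff_exists_fun R).1 (hS (hv t))
    choose c hc using hv'
    -- Both sides are alternating in the n coefficient vectors, so they agree once they agree on the
    -- standard basis.
    let f : (Fin n → R) [⋀^Fin n]→ₗ[R] ExteriorAlgebra R M :=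
      (ιMulti R n).compLinearMap (Fintype.linearCombination R e)
    let g : (Fin n → R) [⋀^Fin n]→ₗ[R] ExteriorAlgebra R M :=
      (LinearMap.toSpanSingleton R _ (ιMulti R n e)).compAlternatingMap
        (Pi.basisFun R (Fin n)).det
    have hfg : f = g := by
      refine (Pi.basisFun R (Fin n)).ext_alternating fun i hi => ?_
      obtain ⟨σ, rfl⟩ : ∃ σ : Equiv.Perm (Fin n), i = σ :=
        ⟨Equiv.ofBijective i (Finite.injective_iff_bijective.1 hi), rfl⟩
      have h1 := f.map_perm (Pi.basisFun R (Fin n)) σ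
      have h2 := g.map_perm (Pi.basisFun R (Fin n)) σ
      have h3 : f (Pi.basisFun R (Fin n)) = g (Pi.basisFun R (Fin n)) := by
        simp only [f, g, AlternatingMap.compLinearMap_apply,
          LinearMap.compAlternatingMap_apply, Module.Basis.det_self,
          LinearMap.toSpanSingleton_apply, one_smul]
        congr 1
        ext t
        simp [Fintype.linearCombination_apply]
      exact h1.trans (by rw [h3]; exact h2.symm)
    refine ⟨(Pi.basisFun R (Fin n)).det c, ?_⟩
    have := congrArg (fun F => F c) hfg
    simp only [f, g, AlternatingMap.compLinearMap_apply, LinearMap.compAlternatingMap_apply,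
      LinearMap.toSpanSingleton_apply] at this
    rw [← this]
    congr 1
    ext t
    simp [Fintype.linearCombination_apply, hc]
  | zero => exact ⟨0, by simp⟩
  | add a b _ _ ha hb =>
    obtain ⟨c, rfl⟩ := ha
    obtain ⟨d, rfl⟩ := hb
    exact ⟨c + d, by rw [add_smul]⟩
  | smul r a _ ha =>
    obtain ⟨c, rfl⟩ := ha
    exact ⟨r * c, by rw [smul_smul]⟩

end ExteriorAlgebra

/-! ### Conjugation, sums of squares and Lelong positivity -/

section FormAlgebra

open ExteriorAlgebra

variable {V : Type*} [NormedAddCommGroup V] [NormedSpace ℂ V]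

theorem Complex.I_pow_succ_sq (k : ℕ) :
    Complex.I ^ ((k + 1) ^ 2) = Complex.I * Complex.I ^ (k ^ 2) * (-1) ^ k := by
  rw [← Complex.I_sq, ← pow_mul, ← pow_succ', ← pow_add]
  congr 1
  ring

/-- Moving every `x t` to the left of every `y t` costs (-1)^(k(k-1)/2) = i^(k(k-1)), which together
with i^k gives i^(k²). -/
theorem prod_ofFn_I_smul_mul {k : ℕ} (x y : Fin k → Covector V) :
    (List.ofFn fun t => Complex.I • (oneForm (x t) * oneForm (y t))).prod
      = Complex.I ^ (k ^ 2) • (ιMulti ℂ k x * ιMulti ℂ k y) := by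
  induction k with
  | zero => simp
  | succ k ih =>
    rw [List.ofFn_succ, List.prod_cons, ih (fun t => x t.succ) (fun t => y t.succ),
      ιMulti_succ_apply, ιMulti_succ_apply, Complex.I_pow_succ_sq]
    have h := ι_mul_of_mem_exteriorPower (R := ℂ) (y 0)
      (ιMulti_mem_exteriorPower (R := ℂ) (Matrix.vecTail x))
    change Complex.I • (ι ℂ (x 0) * ι ℂ (y 0)) * Complex.I ^ k ^ 2 •
      (ιMulti ℂ k (Matrix.vecTail x) * ιMulti ℂ k (Matrix.vecTail y)) = _
    rw [smul_mul_smul_comm, mul_assoc, ← mul_assoc (ι ℂ (y 0)), h, mul_smul, smul_mul_assoc,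
      mul_smul_comm, mul_smul, mul_smul]
    simp only [mul_assoc]

theorem elementaryForm_eq {q : ℕ} (α : Fin q → Covector V) :
    elementaryForm α = Complex.I ^ (q ^ 2) •
      (ιMulti ℂ q α * ιMulti ℂ q fun t => conjCovector (α t)) :=
  prod_ofFn_I_smul_mul _ _

theorem conjForm_oneForm (α : Covector V) : conjForm (oneForm α) = oneForm (conjCovector α) :=
  ExteriorAlgebra.lift_ι_apply (A := ConjForms V) ℂ _ _ _

theorem conjForm_algebraMap (c : ℂ) :
    conjForm (algebraMap ℂ (Forms V) c) = algebraMap ℂ (Forms V) ((starRingEnd ℂ) c) :=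
  AlgHom.commutes (ExteriorAlgebra.lift ℂ ⟨conjLift (V := V), fun α =>
    ExteriorAlgebra.ι_sq_zero (R := ℂ) (conjCovector α)⟩ : Forms V →ₐ[ℂ] ConjForms V) c

theorem conjForm_smul (c : ℂ) (u : Forms V) :
    conjForm (c • u) = (starRingEnd ℂ) c • conjForm u := by
  rw [Algebra.smul_def, map_mul, conjForm_algebraMap, ← Algebra.smul_def]

theorem conjForm_ιMulti {n : ℕ} (v : Fin n → Covector V) :
    conjForm (ιMulti ℂ n v) = ιMulti ℂ n fun t => conjCovector (v t) := by
  rw [ιMulti_apply, ιMulti_apply, map_list_prod, List.map_ofFn]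
  congr 2
  ext1 t
  exact conjForm_oneForm (v t)

theorem conjCovector_mem01 {α : Covector V} (hα : α ∈ covectors10 V) :
    conjCovector α ∈ covectors01 V := by
  intro v
  simp [conjCovector, hα v]

theorem conjForm_mem_pow {k : ℕ} {η : Forms V} (hη : η ∈ ((covectors10 V).map oneForm) ^ k) :
    conjForm η ∈ ((covectors01 V).map oneForm) ^ k := by
  induction hη using Submodule.pow_induction_on_left' with
  | algebraMap r =>
    rw [conjForm_algebraMap, pow_zero]
    exact Submodule.algebraMap_mem _
  | add a b i _ _ ha hb => rw [map_add]; exact add_mem ha hb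
  | mem_mul a ha i x _ ih =>
    obtain ⟨z, hz, rfl⟩ := ha
    rw [map_mul, conjForm_oneForm, Nat.succ_eq_add_one, pow_succ']
    exact Submodule.mul_mem_mul (Submodule.mem_map_of_mem (conjCovector_mem01 hz)) ih

theorem mem_bidegree_zero_right {k : ℕ} {η : Forms V} :
    η ∈ bidegree V k 0 ↔ η ∈ ((covectors10 V).map oneForm) ^ k := by
  rw [bidegree, pow_zero, mul_one]

theorem bidegree_le_exteriorPower (p q : ℕ) : bidegree V p q ≤ ⋀[ℂ]^(p + q) (Covector V) := by
  change _ ≤ LinearMap.range (ι ℂ) ^ (p + q)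
  rw [pow_add]
  exact mul_le_mul' (map_ι_pow_le _ p) (map_ι_pow_le _ q)

section SumOfSquares

theorem IsSumOfSquaresForm.zero (k : ℕ) : IsSumOfSquaresForm k (0 : Forms V) :=
  ⟨0, Fin.elim0, fun l => l.elim0, by simp⟩

theorem IsSumOfSquaresForm.add {k : ℕ} {u v : Forms V} (hu : IsSumOfSquaresForm k u)
    (hv : IsSumOfSquaresForm k v) : IsSumOfSquaresForm k (u + v) := by
  obtain ⟨N, η, hη, rfl⟩ := hu
  obtain ⟨N', η', hη', rfl⟩ := hv
  refine ⟨N + N', Fin.append η η', fun l => ?_, ?_⟩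
  · refine Fin.addCases (fun i => ?_) (fun i => ?_) l
    · simpa using hη i
    · simpa using hη' i
  · simp [Fin.sum_univ_add]

theorem IsSumOfSquaresForm.sum {ι : Type*} {k : ℕ} (s : Finset ι) {u : ι → Forms V}
    (hu : ∀ i ∈ s, IsSumOfSquaresForm k (u i)) : IsSumOfSquaresForm k (∑ i ∈ s, u i) :=
  Finset.sum_induction _ _ (fun _ _ => IsSumOfSquaresForm.add) (IsSumOfSquaresForm.zero k) hu

theorem isSumOfSquaresForm_smul_mul_conjForm {k : ℕ} {η : Forms V} (hη : η ∈ bidegree V k 0)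
    {r : ℝ} (hr : 0 ≤ r) :
    IsSumOfSquaresForm k (((r : ℂ) * Complex.I ^ (k ^ 2)) • (η * conjForm η)) := by
  refine ⟨1, fun _ => ((Real.sqrt r : ℝ) : ℂ) • η, fun _ => Submodule.smul_mem _ _ hη, ?_⟩
  rw [Fin.sum_univ_one, conjForm_smul, smul_mul_smul_comm, smul_smul, Complex.conj_ofReal,
    ← Complex.ofReal_mul, Real.mul_self_sqrt hr, mul_comm]

theorem IsSumOfSquaresForm.mem_bidegree {k : ℕ} {u : Forms V} (hu : IsSumOfSquaresForm k u) :
    u ∈ bidegree V k k := by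
  obtain ⟨N, η, hη, rfl⟩ := hu
  refine Submodule.sum_mem _ fun l _ => Submodule.smul_mem _ _ ?_
  have h := mem_bidegree_zero_right.1 (hη l)
  exact Submodule.mul_mem_mul h (conjForm_mem_pow h)

end SumOfSquares

/-- Commutation with i, together with real linearity, is full complex linearity. -/
theorem map_smul_of_mem10 {α : Covector V} (hα : α ∈ covectors10 V) (c : ℂ) (v : V) :
    α (c • v) = c * α v := by
  conv_lhs => rw [← Complex.re_add_im c, add_smul, mul_comm (c.im : ℂ), mul_smul, map_add, hα]
  rw [Complex.coe_smul, Complex.coe_smul, map_smul, map_smul, Complex.real_smul,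
    Complex.real_smul]
  conv_rhs => rw [← Complex.re_add_im c]
  ring

theorem map_smul_of_mem01 {α : Covector V} (hα : α ∈ covectors01 V) (c : ℂ) (v : V) :
    α (c • v) = (starRingEnd ℂ) c * α v := by
  have h : conjCovector α ∈ covectors10 V := by
    intro w
    simp [conjCovector, hα w]
  have := congrArg (starRingEnd ℂ) (map_smul_of_mem10 h c v)
  simpa [conjCovector] using this

/-- The complex coordinates of a basis, as `(1,0)`-covectors. -/
def coordCovector [FiniteDimensional ℂ V] {n : ℕ} (e : Module.Basis (Fin n) ℂ V) (p : Fin n) :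
    Covector V :=
  (LinearMap.toContinuousLinearMap (e.coord p)).restrictScalars ℝ

section Coordinates

variable [FiniteDimensional ℂ V] {n : ℕ} (e : Module.Basis (Fin n) ℂ V)

theorem coordCovector_apply (p : Fin n) (v : V) : coordCovector e p v = e.repr v p := rfl

theorem coordCovector_mem10 (p : Fin n) : coordCovector e p ∈ covectors10 V := by
  intro v
  simp [coordCovector_apply]

theorem eq_sum_coordCovector {α : Covector V} (hα : α ∈ covectors10 V) :
    α = ∑ p, α (e p) • coordCovector e p := by
  ext v
  conv_lhs => rw [← e.sum_repr v, map_sum]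
  simp [map_smul_of_mem10 hα, coordCovector_apply, mul_comm]

theorem eq_sum_conj_coordCovector {α : Covector V} (hα : α ∈ covectors01 V) :
    α = ∑ p, α (e p) • conjCovector (coordCovector e p) := by
  ext v
  conv_lhs => rw [← e.sum_repr v, map_sum]
  simp [map_smul_of_mem01 hα, coordCovector_apply, conjCovector, mul_comm]

theorem exists_eq_smul_ιMulti_coordCovector {ζ : Forms V} (hζ : ζ ∈ bidegree V n 0) :
    ∃ c : ℂ, ζ = c • ιMulti ℂ n (coordCovector e) := by
  refine exists_eq_smul_ιMulti (covectors10 V) (coordCovector e) ?_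
    (mem_bidegree_zero_right.1 hζ)
  intro α hα
  rw [eq_sum_coordCovector e hα]
  exact Submodule.sum_mem _ fun p _ => Submodule.smul_mem _ _ (Submodule.subset_span ⟨p, rfl⟩)

end Coordinates

/-- Passing `conjForm η` across the product of the `α t` costs (-1)^(kq) = i^(2kq), the cross term
in (k + q)². -/
theorem square_mul_elementaryForm {k q : ℕ} {η : Forms V} (hη : η ∈ bidegree V k 0)
    (α : Fin q → Covector V) :
    (Complex.I ^ (k ^ 2) • (η * conjForm η)) * elementaryForm α
      = Complex.I ^ ((k + q) ^ 2) • ((η * ιMulti ℂ q α) * conjForm (η * ιMulti ℂ q α)) := by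
  have h1 : conjForm η ∈ ⋀[ℂ]^k (Covector V) :=
    map_ι_pow_le _ k (conjForm_mem_pow (mem_bidegree_zero_right.1 hη))
  have h2 := mul_comm_of_mem_exteriorPower h1 (ιMulti_mem_exteriorPower (R := ℂ) α)
  have h3 : Complex.I ^ ((k + q) ^ 2)
      = Complex.I ^ (k ^ 2) * Complex.I ^ (q ^ 2) * (-1) ^ (k * q) := by
    rw [← Complex.I_sq, ← pow_mul, ← pow_add, ← pow_add]
    congr 1
    ring
  rw [elementaryForm_eq, ← conjForm_ιMulti, smul_mul_smul_comm, map_mul, h3, mul_smul]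
  simp only [mul_smul]
  congr 2
  rw [mul_assoc, ← mul_assoc (conjForm η), h2, smul_mul_assoc, mul_smul_comm]
  simp only [mul_assoc]

/-- When k + q = n, each `η l` times the product of the `α t` is a multiple c of dz₁ ∧ … ∧ dz_n, so
each square contributes |c|² times the standard positive top form. -/
theorem IsSumOfSquaresForm.isPositiveForm [FiniteDimensional ℂ V] {k : ℕ} {u : Forms V}
    (hu : IsSumOfSquaresForm k u) : IsPositiveForm k u := by
  refine ⟨hu.mem_bidegree, fun q α hq hα => ?_⟩
  obtain ⟨N, η, hη, rfl⟩ := hu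
  let e := Module.finBasis ℂ V
  have key : ∀ l, ∃ c : ℂ, η l * ιMulti ℂ q α = c • ιMulti ℂ _ (coordCovector e) := by
    intro l
    refine exists_eq_smul_ιMulti_coordCovector e (mem_bidegree_zero_right.2 ?_)
    rw [← hq, pow_add]
    exact Submodule.mul_mem_mul (mem_bidegree_zero_right.1 (hη l))
      (ιMulti_mem_map_pow (covectors10 V) hα)
  choose c hc using key
  refine ⟨∑ l, Complex.normSq (c l), coordCovector e,
    Finset.sum_nonneg fun l _ => Complex.normSq_nonneg _, coordCovector_mem10 e, ?_⟩
  rw [Finset.sum_mul, Complex.ofReal_sum, Finset.sum_smul]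
  refine Finset.sum_congr rfl fun l _ => ?_
  rw [square_mul_elementaryForm (hη l), hc, conjForm_smul, smul_mul_smul_comm, elementaryForm_eq,
    conjForm_ιMulti, Complex.mul_conj, hq, smul_comm]

end FormAlgebra

/-! ### Determinants of matrices of two-forms -/

section EvenForms

open ExteriorAlgebra

variable {V : Type*} [NormedAddCommGroup V] [NormedSpace ℂ V]

/-- The subalgebra of forms generated by the two-forms; it is commutative. -/
abbrev EvenForms (V : Type*) [NormedAddCommGroup V] [NormedSpace ℂ V] : Subalgebra ℂ (Forms V) :=
  Algebra.adjoin ℂ (⋀[ℂ]^2 (Covector V) : Set (Forms V))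

/-- Two-forms commute with each other, so matrices over this subalgebra have a genuine determinant
with all its identities. -/
theorem isMulCommutative_evenForms : IsMulCommutative (EvenForms V) :=
  Algebra.isMulCommutative_adjoin ℂ fun a ha b hb => by
    rw [mul_comm_of_mem_exteriorPower ha hb, Even.neg_one_pow (by decide), one_smul]

instance : CommRing (EvenForms V) :=
  { (inferInstance : Ring (EvenForms V)) with
    mul_comm := isMulCommutative_evenForms.is_comm.comm }

/-- The enumeration `e` of the index set lets the same Leibniz formula serve the total Chern form
and the principal minors, which are indexed by finite subsets. -/
theorem coe_det_evenForms {ι : Type*} [Fintype ι] [DecidableEq ι]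
    (M : Matrix ι ι (EvenForms V)) {n : ℕ} (e : Fin n ≃ ι) :
    ((M.det : EvenForms V) : Forms V) = ∑ σ : Equiv.Perm (Fin n), (Equiv.Perm.sign σ : ℤ) •
      (List.ofFn fun j => ((M (e (σ j)) (e j) : EvenForms V) : Forms V)).prod := by
  rw [← Matrix.det_submatrix_equiv_self e, Matrix.det_apply, AddSubmonoidClass.coe_finsetSum]
  refine Finset.sum_congr rfl fun σ _ => ?_
  rw [Units.smul_def]
  change (EvenForms V).val ((Equiv.Perm.sign σ : ℤ) • _) = _
  rw [map_zsmul, ← List.prod_ofFn, map_list_prod, List.map_ofFn]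
  rfl

theorem ιMulti_comp_perm {n : ℕ} (v : Fin n → Covector V) (σ : Equiv.Perm (Fin n)) :
    ιMulti ℂ n (fun t => v (σ t)) = (Equiv.Perm.sign σ : ℤ) • ιMulti ℂ n v := by
  have := (ιMulti ℂ n).map_perm v σ
  rwa [Units.smul_def] at this

theorem List.prod_ofFn_sum {A κ : Type*} [Semiring A] [Fintype κ] [DecidableEq κ] {n : ℕ}
    (g : Fin n → κ → A) : (List.ofFn fun t => ∑ r, g t r).prod
      = ∑ r : Fin n → κ, (List.ofFn fun t => g t (r t)).prod := by
  induction n with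
  | zero => simp
  | succ n ih =>
    rw [List.ofFn_succ, List.prod_cons, ih (fun t => g t.succ), Finset.sum_mul_sum,
      ← Fintype.sum_prod_type',
      ← (Fin.consEquiv fun _ : Fin (n + 1) => κ).sum_comp]
    refine Finset.sum_congr rfl fun p _ => ?_
    simp [List.ofFn_succ, Fin.consEquiv]

/-- The determinant of `(i/2π) ∑ β_r ∧ β_r^*` is a sum of squares. -/
theorem isSumOfSquaresForm_det {κ : Type*} [Fintype κ] {k : ℕ} (β : κ → Fin k → Covector V)
    (hβ : ∀ r j, β r j ∈ covectors10 V) :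
    IsSumOfSquaresForm k (∑ σ : Equiv.Perm (Fin k), (Equiv.Perm.sign σ : ℤ) •
      (List.ofFn fun j => (Complex.I / (2 * (Real.pi : ℂ))) •
        ∑ r, oneForm (β r (σ j)) * oneForm (conjCovector (β r j))).prod) := by
  classical
  -- The scalar i/2π is split as `a` times i: the factor `a` is positive, and the factors i assemble
  -- into i^(k²).
  set a : ℝ := 1 / (2 * Real.pi) with ha
  have ha0 : 0 ≤ a := by positivity
  let H : (Fin k → κ) → Forms V := fun r => ιMulti ℂ k fun t => β (r t) t
  have hH : ∀ r, H r ∈ bidegree V k 0 := fun r =>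
    mem_bidegree_zero_right.2 (ιMulti_mem_map_pow _ fun t => hβ _ _)
  have h1 : ∀ σ : Equiv.Perm (Fin k), (Equiv.Perm.sign σ : ℤ) •
      (List.ofFn fun j => (Complex.I / (2 * (Real.pi : ℂ))) •
        ∑ r, oneForm (β r (σ j)) * oneForm (conjCovector (β r j))).prod
      = ((a ^ k : ℝ) * Complex.I ^ (k ^ 2) : ℂ) •
        ∑ r : Fin k → κ, H (r ∘ ⇑σ⁻¹) * conjForm (H r) := by
    intro σ
    have e1 : ∀ j, (Complex.I / (2 * (Real.pi : ℂ))) •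
        ∑ r, oneForm (β r (σ j)) * oneForm (conjCovector (β r j))
        = ∑ r, (a : ℂ) • (Complex.I • (oneForm (β r (σ j)) * oneForm (conjCovector (β r j)))) := by
      intro j
      rw [Finset.smul_sum]
      refine Finset.sum_congr rfl fun r _ => ?_
      rw [smul_smul, ha]
      congr 1
      push_cast
      ring
    have e2 : ∀ u : Fin k → Forms V, (List.ofFn fun j => (a : ℂ) • u j).prod
        = (a : ℂ) ^ k • (List.ofFn u).prod := by
      intro u
      clear * -
      induction k with
      | zero => simp
      | succ k ih => rw [List.ofFn_succ, List.prod_cons, ih (fun t => u t.succ), List.ofFn_succ,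
          List.prod_cons, smul_mul_smul_comm, pow_succ']
    simp_rw [e1]
    rw [List.prod_ofFn_sum, Finset.smul_sum, Finset.smul_sum]
    refine Finset.sum_congr rfl fun r _ => ?_
    -- Sorting the factors by their second index yields the sign of σ, whose product with the sign
    -- in the determinant is 1.
    have e3 : ιMulti ℂ k (fun t => β (r t) (σ t)) =
        (Equiv.Perm.sign σ : ℤ) • H (r ∘ ⇑σ⁻¹) := by
      rw [← ιMulti_comp_perm]
      simp
    rw [e2 fun j => Complex.I • (oneForm (β (r j) (σ j)) * oneForm (conjCovector (β (r j) j))),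
      prod_ofFn_I_smul_mul, e3, conjForm_ιMulti, smul_mul_assoc, smul_smul, smul_comm _ (_ : ℤ),
      smul_smul, ← Units.val_mul, Int.units_mul_self, Units.val_one, one_smul]
    push_cast
    rfl
  -- Replacing r by r∘τ, and then σ by σ⁻¹τ, shows that the double sum may be written with any τ in
  -- the conjugated factor.
  have h2 : ∀ τ : Equiv.Perm (Fin k), (∑ σ : Equiv.Perm (Fin k),
      ∑ r : Fin k → κ, H (r ∘ ⇑σ⁻¹) * conjForm (H r))
      = ∑ r : Fin k → κ, (∑ σ : Equiv.Perm (Fin k), H (r ∘ σ)) * conjForm (H (r ∘ τ)) := by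
    intro τ
    rw [Finset.sum_comm, ← (Equiv.arrowCongr τ⁻¹ (Equiv.refl κ)).sum_comp]
    refine Finset.sum_congr rfl fun r _ => ?_
    have e : ∀ r : Fin k → κ, (Equiv.arrowCongr τ⁻¹ (Equiv.refl κ)) r = r ∘ τ := fun r => rfl
    rw [e, ← Finset.sum_mul]
    congr 1
    rw [← ((Equiv.inv (Equiv.Perm (Fin k))).trans (Equiv.mulRight τ)).sum_comp]
    refine Finset.sum_congr rfl fun σ _ => ?_
    congr 1
    ext t
    simp
  -- Averaging the previous identity over all τ symmetrizes the second factor as well.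
  have h3 : (∑ σ : Equiv.Perm (Fin k), ∑ r : Fin k → κ, H (r ∘ ⇑σ⁻¹) * conjForm (H r))
      = ((k.factorial : ℂ)⁻¹) • ∑ r : Fin k → κ, (∑ σ : Equiv.Perm (Fin k), H (r ∘ σ))
          * conjForm (∑ σ : Equiv.Perm (Fin k), H (r ∘ σ)) := by
    rw [eq_inv_smul_iff₀ (by exact_mod_cast k.factorial_ne_zero)]
    have e : (k.factorial : ℂ) • (∑ σ : Equiv.Perm (Fin k),
        ∑ r : Fin k → κ, H (r ∘ ⇑σ⁻¹) * conjForm (H r)) = ∑ _τ : Equiv.Perm (Fin k),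
        (∑ σ : Equiv.Perm (Fin k), ∑ r : Fin k → κ, H (r ∘ ⇑σ⁻¹) * conjForm (H r)) := by
      rw [Finset.sum_const, Finset.card_univ, Fintype.card_perm, Fintype.card_fin,
        Nat.cast_smul_eq_nsmul]
    rw [e, Finset.sum_congr rfl fun τ _ => h2 τ, Finset.sum_comm]
    refine Finset.sum_congr rfl fun r _ => ?_
    rw [map_sum, Finset.mul_sum]
  rw [Finset.sum_congr rfl fun σ _ => h1 σ, ← Finset.smul_sum, h3, smul_smul, Finset.smul_sum]
  refine IsSumOfSquaresForm.sum _ fun r _ => ?_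
  have e : ((a ^ k : ℝ) * Complex.I ^ (k ^ 2) * (k.factorial : ℂ)⁻¹ : ℂ)
      = ((a ^ k * (k.factorial : ℝ)⁻¹ : ℝ) : ℂ) * Complex.I ^ (k ^ 2) := by
    push_cast
    ring
  rw [e]
  exact isSumOfSquaresForm_smul_mul_conjForm (Submodule.sum_mem _ fun σ _ => hH _)
    (by positivity)

theorem coe_decompose_sum_range {u : ℕ → Forms V} (hu : ∀ j, u j ∈ ⋀[ℂ]^(2 * j) (Covector V))
    (N k : ℕ) :
    (DirectSum.decompose (fun i : ℕ => ⋀[ℂ]^i (Covector V)) (∑ j ∈ Finset.range N, u j) (2 * k) :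
      Forms V) = if k < N then u k else 0 := by
  rw [DirectSum.decompose_sum, DFinsupp.finsetSum_apply, AddSubmonoidClass.coe_finsetSum]
  split_ifs with h
  · rw [Finset.sum_eq_single_of_mem k (Finset.mem_range.2 h) fun j _ hj =>
      DirectSum.decompose_of_mem_ne (fun i : ℕ => ⋀[ℂ]^i (Covector V)) (hu j)
        (fun h => hj (Nat.eq_of_mul_eq_mul_left two_pos h)),
      DirectSum.decompose_of_mem_same (fun i : ℕ => ⋀[ℂ]^i (Covector V)) (hu k)]
  · refine Finset.sum_eq_zero fun j hj => 
      DirectSum.decompose_of_mem_ne (fun i : ℕ => ⋀[ℂ]^i (Covector V)) (hu j) ?_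
    have := Finset.mem_range.1 hj
    lia

/-- The component of degree `2k` of `det(1 + (i/2π) M)` is a sum of squares for
`M = ∑ β_r ∧ β_r^*`. -/
theorem isSumOfSquaresForm_decompose_det_one_add {κ : Type*} [Fintype κ] {m : ℕ}
    (β : κ → Fin m → Covector V) (hβ : ∀ r j, β r j ∈ covectors10 V)
    (M : Matrix (Fin m) (Fin m) (EvenForms V))
    (hM : ∀ i j, ((M i j : EvenForms V) : Forms V)
      = ∑ r, oneForm (β r i) * oneForm (conjCovector (β r j))) (k : ℕ) :
    IsSumOfSquaresForm k
      (DirectSum.decompose (fun i : ℕ => ⋀[ℂ]^i (Covector V))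
        (((1 + (Complex.I / (2 * (Real.pi : ℂ))) • M).det : EvenForms V) : Forms V) (2 * k) :
        Forms V) := by
  set N := (Complex.I / (2 * (Real.pi : ℂ))) • M with hN
  -- The coefficient of X^j in det(1 + XN) is the sum of the principal j × j minors of N. Each has
  -- degree 2j as a form, so evaluating at 1 leaves the coefficients in distinct degrees.
  let p : Polynomial (EvenForms V) := (1 + (Polynomial.X : Polynomial (EvenForms V)) •
    N.map Polynomial.C).det
  have hp : (1 + N).det = p.eval 1 := by
    rw [← Polynomial.coe_evalRingHom, RingHom.map_det]
    congr 1
    ext1 i j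
    by_cases hij : i = j <;> simp [hij]
  have hminor : ∀ j, IsSumOfSquaresForm j ((p.coeff j : EvenForms V) : Forms V) := by
    intro j
    simp only [p, Matrix.coeff_det_one_add_X_smul_eq_sum_minors]
    rw [AddSubmonoidClass.coe_finsetSum]
    refine IsSumOfSquaresForm.sum _ fun s hs => ?_
    have hs' : s.card = j := (Finset.mem_powersetCard.1 hs).2
    let e : Fin j ≃ s := (s.equivFinOfCardEq hs').symm
    rw [coe_det_evenForms _ e]
    have := isSumOfSquaresForm_det (fun r t => β r (e t)) fun r t => hβ r _
    convert this using 7 with σ _ t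
    simp only [Matrix.submatrix_apply, hN, Matrix.smul_apply]
    rw [← hM]
    rfl
  have hmem : ∀ j, ((p.coeff j : EvenForms V) : Forms V) ∈ ⋀[ℂ]^(2 * j) (Covector V) := fun j => by
    rw [two_mul]
    exact bidegree_le_exteriorPower j j (hminor j).mem_bidegree
  rw [hp, Polynomial.eval_eq_sum_range, AddSubmonoidClass.coe_finsetSum]
  simp only [one_pow, mul_one]
  rw [coe_decompose_sum_range hmem]
  split_ifs
  · exact hminor k
  · exact IsSumOfSquaresForm.zero k

end EvenForms

/-! ### The curvature of the Chern connection has type (1,1) -/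

section ChernConnection

variable {V : Type*} [NormedAddCommGroup V] [NormedSpace ℂ V]

theorem part10_mem10 (α : Covector V) : part10 α ∈ covectors10 V := by
  intro v
  simp only [part10, mulI, smul_apply, sub_apply, ContinuousLinearMap.comp_apply,
    ContinuousLinearMap.coe_restrictScalars', ContinuousLinearMap.id_apply, smul_smul,
    Complex.I_mul_I, neg_smul, one_smul, map_neg, smul_eq_mul]
  linear_combination (1 / 2 * α (Complex.I • v)) * Complex.I_mul_I

theorem sub_part10_mem01 (α : Covector V) : α - part10 α ∈ covectors01 V := by
  intro v
  simp only [part10, mulI, smul_apply, sub_apply, ContinuousLinearMap.comp_apply,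
    ContinuousLinearMap.coe_restrictScalars', ContinuousLinearMap.id_apply, smul_smul,
    Complex.I_mul_I, neg_smul, one_smul, map_neg, smul_eq_mul]
  linear_combination (1 / 2 * α (Complex.I • v)) * Complex.I_mul_I

/-- Taking the `(1,0)`-part, as a continuous real-linear map. -/
def part10L (V : Type*) [NormedAddCommGroup V] [NormedSpace ℂ V] :
    Covector V →L[ℝ] Covector V :=
  (1 / 2 : ℂ) • (ContinuousLinearMap.id ℝ (Covector V)
    - Complex.I • (ContinuousLinearMap.compL ℝ V V ℂ).flip (mulI V))

theorem part10L_apply (α : Covector V) : part10L V α = part10 α := rfl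

theorem part10_sum_smul {ι : Type*} (s : Finset ι) (c : ι → ℂ) (α : ι → Covector V) :
    part10 (∑ i ∈ s, c i • α i) = ∑ i ∈ s, c i • part10 (α i) := by
  rw [← part10L_apply, map_sum]
  refine Finset.sum_congr rfl fun i _ => ?_
  ext v
  simp only [part10L_apply, part10, smul_apply, sub_apply, ContinuousLinearMap.comp_apply,
    smul_eq_mul]
  ring

theorem mul_mem_bidegree_one_one {α β : Covector V} (hα : α ∈ covectors10 V)
    (hβ : β ∈ covectors01 V) : oneForm α * oneForm β ∈ bidegree V 1 1 := by
  rw [bidegree, pow_one, pow_one]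
  exact Submodule.mul_mem_mul (Submodule.mem_map_of_mem hα) (Submodule.mem_map_of_mem hβ)

theorem oneForm_mul_swap (α β : Covector V) : oneForm α * oneForm β = -(oneForm β * oneForm α) :=
  eq_neg_of_add_eq_zero_left (ExteriorAlgebra.ι_add_mul_swap α β)

variable [FiniteDimensional ℂ V]

/-- The real coordinates of the basis used in `extDerivOneForm`, as covectors. -/
def realCoord (i : Fin (Module.finrank ℝ V)) : Covector V :=
  Complex.ofRealCLM.comp (LinearMap.toContinuousLinearMap ((Module.finBasis ℝ V).coord i))

theorem sum_smul_realCoord (α : Covector V) :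
    ∑ i, α (Module.finBasis ℝ V i) • realCoord i = α := by
  ext v
  conv_rhs => rw [← (Module.finBasis ℝ V).sum_repr v, map_sum]
  simp [realCoord, mul_comm]

/-- `∂∂g = 0`. -/
theorem sum_part10_mul_part10_eq_zero (L : V →L[ℝ] Covector V) (hL : ∀ v w, L v w = L w v) :
    ∑ i, oneForm (part10 (realCoord i)) * oneForm (part10 (L (Module.finBasis ℝ V i))) = 0 := by
  set b := Module.finBasis ℝ V
  have h1 : ∀ i, part10 (L (b i)) = ∑ j, L (b i) (b j) • part10 (realCoord j) := fun i => by
    rw [← part10_sum_smul, sum_smul_realCoord]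
  have h2 : ∑ i, oneForm (part10 (realCoord i)) * oneForm (part10 (L (b i)))
      = ∑ i, ∑ j, L (b i) (b j) •
        (oneForm (part10 (realCoord i)) * oneForm (part10 (realCoord j))) := by
    simp only [h1, map_sum, map_smul, Finset.mul_sum, mul_smul_comm]
  -- The second derivative is symmetric and the wedge product antisymmetric, so the sum equals its
  -- own negative.
  have h3 : ∑ i, oneForm (part10 (realCoord i)) * oneForm (part10 (L (b i)))
      = -∑ i, oneForm (part10 (realCoord i)) * oneForm (part10 (L (b i))) := by
    conv_lhs => rw [h2, Finset.sum_comm]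
    rw [h2]
    simp only [← Finset.sum_neg_distrib]
    refine Finset.sum_congr rfl fun i _ => Finset.sum_congr rfl fun j _ => ?_
    rw [hL, oneForm_mul_swap, smul_neg]
  have h4 : (2 : ℂ) • ∑ i, oneForm (part10 (realCoord i)) * oneForm (part10 (L (b i))) = 0 := by
    rw [two_smul]
    exact eq_neg_iff_add_eq_zero.1 h3
  exact (smul_eq_zero.1 h4).resolve_left two_ne_zero

/-- Since ∂∂g = 0, the form d∂g equals ∂̄∂g. -/
theorem extDerivOneForm_delFun_mem {g : V → ℂ} {z : V} (hg : ContDiffAt ℝ 2 g z) :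
    extDerivOneForm (delFun g) z ∈ bidegree V 1 1 := by
  have hd : DifferentiableAt ℝ (fderiv ℝ g) z :=
    (hg.fderiv_right (m := 1) (by norm_num)).differentiableAt (by norm_num)
  have h1 : fderiv ℝ (delFun g) z = (part10L V).comp (fderiv ℝ (fderiv ℝ g) z) :=
    ((part10L V).hasFDerivAt.comp z hd.hasFDerivAt).fderiv
  set L := fderiv ℝ (fderiv ℝ g) z with hL
  have hsymm : ∀ v w, L v w = L w v := fun v w =>
    (hg.isSymmSndFDerivAt (by simp [minSmoothness_of_isRCLikeNormedField])).eq v w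
  have h2 : extDerivOneForm (delFun g) z
      = ∑ i, oneForm (realCoord i) * oneForm (part10 (L (Module.finBasis ℝ V i))) := by
    rw [extDerivOneForm, h1]
    rfl
  have h3 : ∑ i, oneForm (realCoord i) * oneForm (part10 (L (Module.finBasis ℝ V i)))
      = ∑ i, oneForm (realCoord i - part10 (realCoord i)) *
        oneForm (part10 (L (Module.finBasis ℝ V i))) := by
    simp only [map_sub, sub_mul, Finset.sum_sub_distrib, sum_part10_mul_part10_eq_zero L hsymm,
      sub_zero]
  rw [h2, h3]
  refine Submodule.sum_mem _ fun i _ => ?_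
  rw [oneForm_mul_swap]
  exact Submodule.neg_mem _ (mul_mem_bidegree_one_one (part10_mem10 _) (sub_part10_mem01 _))

theorem extDerivOneForm_congr {θ η : V → Covector V} {z : V} (h : θ =ᶠ[nhds z] η) :
    extDerivOneForm θ z = extDerivOneForm η z := by
  rw [extDerivOneForm, extDerivOneForm, h.fderiv_eq]

/-- This is the Leibniz rule d(gθ) = g dθ + dg ∧ θ, needed to differentiate Gθ = ∂G. -/
theorem extDerivOneForm_sum_smul {ι : Type*} [Fintype ι] {g : ι → V → ℂ}
    {θ : ι → V → Covector V} {z : V} (hg : ∀ l, DifferentiableAt ℝ (g l) z)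
    (hθ : ∀ l, DifferentiableAt ℝ (θ l) z) :
    extDerivOneForm (fun y => ∑ l, g l y • θ l y) z = ∑ l, (g l z • extDerivOneForm (θ l) z
      + oneForm (fderiv ℝ (g l) z) * oneForm (θ l z)) := by
  have h1 : fderiv ℝ (fun y => ∑ l, g l y • θ l y) z
      = ∑ l, (g l z • fderiv ℝ (θ l) z + (fderiv ℝ (g l) z).smulRight (θ l z)) :=
    (HasFDerivAt.fun_sum fun l _ => (hg l).hasFDerivAt.smul (hθ l).hasFDerivAt).fderiv
  have h2 : ∀ i, fderiv ℝ (fun y => ∑ l, g l y • θ l y) z (Module.finBasis ℝ V i)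
      = ∑ l, (g l z • fderiv ℝ (θ l) z (Module.finBasis ℝ V i)
        + fderiv ℝ (g l) z (Module.finBasis ℝ V i) • θ l z) := by
    intro i
    rw [h1]
    simp [sum_apply]
  change ∑ i, oneForm (realCoord i) * _ = _
  simp only [h2, map_sum, Finset.mul_sum]
  rw [Finset.sum_comm]
  refine Finset.sum_congr rfl fun l _ => ?_
  simp only [map_add, map_smul, mul_add, Finset.sum_add_distrib, mul_smul_comm, ← Finset.smul_sum]
  congr 1
  conv_rhs => rw [← sum_smul_realCoord (fderiv ℝ (g l) z)]
  simp only [map_sum, map_smul, Finset.sum_mul, smul_mul_assoc]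

section Matrix

variable {E ι : Type*} [NormedAddCommGroup E] [NormedSpace ℝ E] [Fintype ι] [DecidableEq ι]

theorem DifferentiableAt.matrix_det {M : E → Matrix ι ι ℂ} {z : E}
    (hM : ∀ i j, DifferentiableAt ℝ (fun y => M y i j) z) :
    DifferentiableAt ℝ (fun y => (M y).det) z := by
  simp only [Matrix.det_apply]
  refine DifferentiableAt.fun_sum fun σ _ => ?_
  have : DifferentiableAt ℝ (fun y => ∏ i, M y (σ i) i) z :=
    (HasFDerivAt.finsetProd fun i _ => (hM (σ i) i).hasFDerivAt).differentiableAt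
  simp only [Units.smul_def, zsmul_eq_mul]
  exact this.const_mul _

theorem DifferentiableAt.matrix_inv_apply {M : E → Matrix ι ι ℂ} {z : E}
    (hM : ∀ i j, DifferentiableAt ℝ (fun y => M y i j) z) (hz : (M z).det ≠ 0) (i j : ι) :
    DifferentiableAt ℝ (fun y => (M y)⁻¹ i j) z := by
  simp only [Matrix.inv_def, Ring.inverse_eq_inv', Matrix.smul_apply, smul_eq_mul]
  refine ((DifferentiableAt.matrix_det hM).inv hz).mul ?_
  simp only [Matrix.adjugate_apply]
  refine DifferentiableAt.matrix_det fun a b => ?_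
  by_cases h : a = j
  · subst h; simp
  · simpa [Matrix.updateRow_apply, h] using hM a b

end Matrix

/-- The curvature of a Chern connection, with the first index lowered by the metric, is of
type `(1,1)`. -/
theorem sum_gram_smul_curvature_mem {ι : Type*} [Fintype ι] [DecidableEq ι]
    {G : V → Matrix ι ι ℂ} {z : V} (hG : ∀ i j, ContDiffAt ℝ 2 (fun y => G y i j) z)
    (hz : (G z).det ≠ 0) {θ : ι → ι → V → Covector V}
    (hθ : ∀ j k y, θ j k y = ∑ l, (G y)⁻¹ j l • delFun (fun y => G y l k) y) (j k : ι) :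
    ∑ l, G z j l • (extDerivOneForm (θ l k) z + ∑ r, oneForm (θ l r z) * oneForm (θ r k z))
      ∈ bidegree V 1 1 := by
  have hGd : ∀ i j, DifferentiableAt ℝ (fun y => G y i j) z := fun i j =>
    (hG i j).differentiableAt (by norm_num)
  have hdel : ∀ i j, DifferentiableAt ℝ (delFun fun y => G y i j) z := fun i j =>
    (part10L V).differentiableAt.comp z
      (((hG i j).fderiv_right (m := 1) (by norm_num)).differentiableAt (by norm_num))
  have hθd : ∀ i j, DifferentiableAt ℝ (θ i j) z := fun i j => by
    have : θ i j = fun y => ∑ l, (G y)⁻¹ i l • delFun (fun y => G y l j) y := funext (hθ i j)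
    rw [this]
    exact DifferentiableAt.fun_sum fun l _ =>
      (DifferentiableAt.matrix_inv_apply hGd hz i l).smul (hdel l j)
  have hθ10 : ∀ i j, θ i j z ∈ covectors10 V := fun i j => by
    rw [hθ]
    exact Submodule.sum_mem _ fun l _ => Submodule.smul_mem _ _ (part10_mem10 _)
  have hsolve : ∀ y, (G y).det ≠ 0 → ∀ i j,
      ∑ l, G y i l • θ l j y = delFun (fun y => G y i j) y := by
    intro y hy i j
    have h1 : G y * (G y)⁻¹ = 1 := Matrix.mul_nonsing_inv _ (isUnit_iff_ne_zero.2 hy)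
    simp only [hθ, Finset.smul_sum, smul_smul]
    rw [Finset.sum_comm]
    simp only [← Finset.sum_smul, ← Matrix.mul_apply, h1]
    simp [Matrix.one_apply]
  -- To be differentiated, Gθ = ∂G must hold near z; the determinant of G stays nonzero there by
  -- continuity.
  have hev : (fun y => ∑ l, G y j l • θ l k y) =ᶠ[nhds z] delFun fun y => G y j k := by
    have := (DifferentiableAt.matrix_det hGd).continuousAt.eventually_ne hz
    filter_upwards [this] with y hy using hsolve y hy j k
  have h1 := extDerivOneForm_sum_smul (fun l => hGd j l) fun l => hθd l k
  rw [extDerivOneForm_congr hev, Finset.sum_add_distrib] at h1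
  have h2 : ∑ l, G z j l • ∑ r, oneForm (θ l r z) * oneForm (θ r k z)
      = ∑ r, oneForm (part10 (fderiv ℝ (fun y => G y j r) z)) * oneForm (θ r k z) := by
    simp only [Finset.smul_sum]
    rw [Finset.sum_comm]
    refine Finset.sum_congr rfl fun r _ => ?_
    rw [← delFun, ← hsolve z hz]
    simp only [map_sum, map_smul, Finset.sum_mul, smul_mul_assoc]
  -- G dθ = d∂G − dG ∧ θ and Gθ ∧ θ = ∂G ∧ θ; their sum leaves only the (0,1)-part of dG in front of
  -- θ.
  have h3 : ∑ l, G z j l • (extDerivOneForm (θ l k) z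
      + ∑ r, oneForm (θ l r z) * oneForm (θ r k z))
      = extDerivOneForm (delFun fun y => G y j k) z
        - ∑ r, oneForm (fderiv ℝ (fun y => G y j r) z - part10 (fderiv ℝ (fun y => G y j r) z))
          * oneForm (θ r k z) := by
    simp only [smul_add, Finset.sum_add_distrib, map_sub, sub_mul, Finset.sum_sub_distrib]
    rw [h2, h1]
    abel
  rw [h3]
  refine Submodule.sub_mem _ (extDerivOneForm_delFun_mem (hG j k))
    (Submodule.sum_mem _ fun r _ => ?_)
  rw [oneForm_mul_swap]
  exact Submodule.neg_mem _ (mul_mem_bidegree_one_one (hθ10 r k) (sub_part10_mem01 _))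

end ChernConnection

/-! ### Positive matrices of (1,1)-forms as sums of rank-one squares -/

section PositiveCurvature

/-- Over ℂ, a real-valued quadratic form already forces the matrix to be Hermitian. -/
theorem Matrix.posSemidef_of_forall_nonneg {ι : Type*} [Fintype ι] {B : Matrix ι ι ℂ}
    (h : ∀ x : ι → ℂ, 0 ≤ star x ⬝ᵥ B.mulVec x) : B.PosSemidef := by
  classical
  rw [← Matrix.isPositive_toEuclideanLin_iff, LinearMap.isPositive_iff_complex]
  intro x
  have h1 : inner ℂ (B.toEuclideanLin x) x
      = (starRingEnd ℂ) (star x.ofLp ⬝ᵥ B.mulVec x.ofLp) := by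
    rw [← inner_conj_symm, EuclideanSpace.inner_eq_star_dotProduct, dotProduct_comm]
    rfl
  obtain ⟨hre, him⟩ := Complex.nonneg_iff.1 (h x.ofLp)
  rw [h1]
  refine ⟨?_, by simpa using hre⟩
  apply Complex.ext
  · simp
  · simp [← him]

variable {V : Type*} [NormedAddCommGroup V] [NormedSpace ℂ V]

theorem evalForm_sum_smul {ι : Type*} (s : Finset ι) (c : ι → ℂ) (u : ι → Forms V) (v w : V) :
    evalForm (∑ i ∈ s, c i • u i) v w = ∑ i ∈ s, c i * evalForm (u i) v w := by
  simp [evalForm, map_sum, map_smul]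

/-- The conjugate covector vanishes on (1,0)-vectors, so only one of the two terms of the
contraction survives. -/
theorem evalForm_mul_conj {α β : Covector V} (hα : α ∈ covectors10 V) (hβ : β ∈ covectors10 V)
    (v w : V) : evalForm (oneForm α * oneForm (conjCovector β)) v w
      = α v * (starRingEnd ℂ) (β w) := by
  have h1 : vec10 v α = α v := by
    change (α v - Complex.I * α (Complex.I • v)) / 2 = _
    rw [hα v]
    linear_combination (-1 / 2 * α v) * Complex.I_mul_I
  have h2 : vec10 v (conjCovector β) = 0 := by
    change (conjCovector β v - Complex.I * conjCovector β (Complex.I • v)) / 2 = _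
    rw [conjCovector_mem01 hβ v]
    linear_combination (1 / 2 * conjCovector β v) * Complex.I_mul_I
  have h3 : vec01 w (conjCovector β) = (starRingEnd ℂ) (β w) := by
    change (conjCovector β w + Complex.I * conjCovector β (Complex.I • w)) / 2 = conjCovector β w
    rw [conjCovector_mem01 hβ w]
    linear_combination (-1 / 2 * conjCovector β w) * Complex.I_mul_I
  have h4 : CliffordAlgebra.contractLeft (vec10 v) (oneForm α * oneForm (conjCovector β))
      = α v • oneForm (conjCovector β) := by
    rw [oneForm, ExteriorAlgebra.ι, CliffordAlgebra.contractLeft_ι_mul,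
      CliffordAlgebra.contractLeft_ι, h1, h2, map_zero, mul_zero, sub_zero]
  rw [evalForm, h4, map_smul, map_smul, oneForm, ExteriorAlgebra.ι,
    CliffordAlgebra.contractLeft_ι, h3]
  exact congrArg (α v * ·) (ExteriorAlgebra.algebraMap_leftInverse _ _)

variable [FiniteDimensional ℂ V]

theorem exists_coord_of_mem_bidegree_one_one {n : ℕ} (e : Module.Basis (Fin n) ℂ V)
    {u : Forms V} (hu : u ∈ bidegree V 1 1) : ∃ c : Fin n × Fin n → ℂ,
      u = ∑ pq, c pq • (oneForm (coordCovector e pq.1) *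
        oneForm (conjCovector (coordCovector e pq.2))) := by
  rw [bidegree, pow_one, pow_one] at hu
  induction hu using Submodule.mul_induction_on' with
  | mem_mul_mem a ha b hb =>
    obtain ⟨α, hα, rfl⟩ := ha
    obtain ⟨β, hβ, rfl⟩ := hb
    refine ⟨fun pq => α (e pq.1) * β (e pq.2), ?_⟩
    conv_lhs => rw [eq_sum_coordCovector e hα, eq_sum_conj_coordCovector e hβ]
    simp only [map_sum, map_smul, Finset.sum_mul_sum, smul_mul_smul_comm]
    rw [Fintype.sum_prod_type]
  | add a _ b _ ha hb =>
    obtain ⟨c, rfl⟩ := ha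
    obtain ⟨d, rfl⟩ := hb
    exact ⟨c + d, by simp [add_smul, Finset.sum_add_distrib]⟩

/-- A matrix of `(1,1)`-forms that defines a positive semidefinite form is a sum of
`β_r ∧ β_r^*`, for columns `β_r` of `(1,0)`-covectors. -/
theorem exists_eq_sum_mul_conj {m : ℕ} (A : Matrix (Fin m) (Fin m) (Forms V))
    (hA : ∀ i j, A i j ∈ bidegree V 1 1)
    (hpos : ∀ v : Fin m → V, 0 ≤ ∑ s, ∑ t, evalForm (A s t) (v s) (v t)) :
    ∃ (N : ℕ) (β : Fin N → Fin m → Covector V), (∀ r i, β r i ∈ covectors10 V) ∧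
      ∀ i j, A i j = ∑ r, oneForm (β r i) * oneForm (conjCovector (β r j)) := by
  let e := Module.finBasis ℂ V
  choose c hc using fun i j => exists_coord_of_mem_bidegree_one_one e (hA i j)
  let B : Matrix (Fin m × Fin (Module.finrank ℂ V)) (Fin m × Fin (Module.finrank ℂ V)) ℂ :=
    Matrix.of fun sp tq => c sp.1 tq.1 (sp.2, tq.2)
  have hB : B.PosSemidef := by
    refine Matrix.posSemidef_of_forall_nonneg fun x => ?_
    -- The evaluation is linear in the first vector and conjugate-linear in the second, whereas
    -- `star x ⬝ᵥ B.mulVec x` conjugates the first factor; hence the conjugated coordinates.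
    have h := hpos fun s => ∑ p, (starRingEnd ℂ) (x (s, p)) • e p
    have hrepr : ∀ s p, coordCovector e p (∑ p, (starRingEnd ℂ) (x (s, p)) • e p)
        = (starRingEnd ℂ) (x (s, p)) := fun s p => by
      rw [coordCovector_apply, e.repr_sum_self]
    convert h using 1
    simp only [dotProduct, Matrix.mulVec, Fintype.sum_prod_type, Finset.mul_sum]
    refine Finset.sum_congr rfl fun s _ => ?_
    rw [Finset.sum_comm]
    refine Finset.sum_congr rfl fun t _ => ?_
    rw [hc s t, evalForm_sum_smul, Fintype.sum_prod_type]
    refine Finset.sum_congr rfl fun p _ => Finset.sum_congr rfl fun q _ => ?_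
    rw [evalForm_mul_conj (coordCovector_mem10 e p) (coordCovector_mem10 e q), hrepr, hrepr,
      Complex.conj_conj]
    simp only [B, Matrix.of_apply, Pi.star_apply, RCLike.star_def]
    ring
  -- Each rank-one term is a vector indexed by pairs (i, p); for fixed i its entries are the
  -- coordinates of the covector β_ri.
  obtain ⟨N, b, hb⟩ := Matrix.posSemidef_iff_eq_sum_vecMulVec.1 hB
  have hb' : ∀ i j p q, c i j (p, q) = ∑ r, b r (i, p) * (starRingEnd ℂ) (b r (j, q)) := by
    intro i j p q
    have := congrFun (congrFun hb (i, p)) (j, q)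
    simpa [B, Matrix.sum_apply, Matrix.vecMulVec_apply] using this
  refine ⟨N, fun r i => ∑ p, b r (i, p) • coordCovector e p, fun r i =>
    Submodule.sum_mem _ fun p _ => Submodule.smul_mem _ _ (coordCovector_mem10 e p), ?_⟩
  intro i j
  have hconj : ∀ r, conjCovector (∑ q, b r (j, q) • coordCovector e q)
      = ∑ q, (starRingEnd ℂ) (b r (j, q)) • conjCovector (coordCovector e q) := fun r => by
    ext v
    simp [conjCovector]
  rw [hc i j]
  simp only [hconj, map_sum, map_smul, Finset.sum_mul_sum, smul_mul_smul_comm, hb',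
    Fintype.sum_prod_type, Finset.sum_smul]
  symm
  rw [Finset.sum_comm]
  refine Finset.sum_congr rfl fun p _ => ?_
  rw [Finset.sum_comm]

end PositiveCurvature

/-! ### The determinant of 1 + (i/2π)HA for positive semidefinite H -/

section ChernForms

open ExteriorAlgebra

section Algebra

variable {V : Type*} [NormedAddCommGroup V] [NormedSpace ℂ V]

theorem conjCovector_sum_smul {ι : Type*} (s : Finset ι) (c : ι → ℂ) (α : ι → Covector V) :
    conjCovector (∑ i ∈ s, c i • α i)
      = ∑ i ∈ s, (starRingEnd ℂ) (c i) • conjCovector (α i) := by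
  ext v
  simp [conjCovector]

theorem bidegree_one_one_le_evenForms {u : Forms V} (hu : u ∈ bidegree V 1 1) :
    u ∈ EvenForms V :=
  Algebra.subset_adjoin (bidegree_le_exteriorPower 1 1 hu)

/-- The shape ∑ β_r ∧ β_r^* survives congruence by a constant matrix, the columns β_r being
transformed linearly. -/
theorem sum_smul_mul_conj {κ ι : Type*} [Fintype κ] [Fintype ι] (β : κ → ι → Covector V)
    (a b : ι → ℂ) :
    ∑ i, ∑ j, (a i * (starRingEnd ℂ) (b j)) •
        ∑ r, oneForm (β r i) * oneForm (conjCovector (β r j))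
      = ∑ r, oneForm (∑ i, a i • β r i) * oneForm (conjCovector (∑ j, b j • β r j)) := by
  simp only [conjCovector_sum_smul, map_sum, map_smul, Finset.sum_mul_sum, smul_mul_smul_comm,
    Finset.smul_sum]
  symm
  rw [Finset.sum_comm]
  refine Finset.sum_congr rfl fun p _ => ?_
  rw [Finset.sum_comm]

/-- The entry `∑ conj (P_{lr}) A_{ll'} P_{l's}` of `Pᴴ A P`. -/
theorem coe_conjTranspose_mul_mul {m n : ℕ} (P : Matrix (Fin m) (Fin n) ℂ)
    (A : Matrix (Fin m) (Fin m) (EvenForms V)) (r s : Fin n) :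
    (((P.conjTranspose.map (algebraMap ℂ (EvenForms V)) * A *
        P.map (algebraMap ℂ (EvenForms V))) r s : EvenForms V) : Forms V)
      = ∑ l, ∑ l', ((starRingEnd ℂ) (P l r) * P l' s) • (A l l' : Forms V) := by
  simp only [Matrix.mul_apply, Matrix.map_apply, Finset.sum_mul]
  rw [Finset.sum_comm, AddSubmonoidClass.coe_finsetSum]
  refine Finset.sum_congr rfl fun l _ => ?_
  rw [AddSubmonoidClass.coe_finsetSum]
  refine Finset.sum_congr rfl fun l' _ => ?_
  rw [mul_comm, ← Algebra.smul_def, ← Algebra.smul_def, smul_smul, mul_comm]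
  rfl

/-- For a positive semidefinite matrix `H`, and for `A` or `Aᵀ` of the form `∑ β_r ∧ β_r^*`, the
component of degree `2k` of `det(1 + (i/2π) H A)` is a sum of squares. -/
theorem isSumOfSquaresForm_decompose_det_one_add_mul {m : ℕ} {H : Matrix (Fin m) (Fin m) ℂ}
    (hH : H.PosSemidef) (A : Matrix (Fin m) (Fin m) (EvenForms V)) {N : ℕ}
    (β : Fin N → Fin m → Covector V) (hβ : ∀ r i, β r i ∈ covectors10 V)
    (hA : (∀ i j, (A i j : Forms V) = ∑ r, oneForm (β r i) * oneForm (conjCovector (β r j))) ∨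
      (∀ i j, (A i j : Forms V) = ∑ r, oneForm (β r j) * oneForm (conjCovector (β r i))))
    (k : ℕ) :
    IsSumOfSquaresForm k
      (DirectSum.decompose (fun i : ℕ => ⋀[ℂ]^i (Covector V))
        (((1 + (Complex.I / (2 * (Real.pi : ℂ))) •
          (H.map (algebraMap ℂ (EvenForms V)) * A)).det : EvenForms V) : Forms V) (2 * k) :
        Forms V) := by
  obtain ⟨n, v, hv⟩ := Matrix.posSemidef_iff_eq_sum_vecMulVec.1 hH
  let P : Matrix (Fin m) (Fin n) ℂ := Matrix.of fun l r => v r l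
  have hP : H = P * P.conjTranspose := by
    ext i j
    rw [hv]
    simp [P, Matrix.mul_apply, Matrix.sum_apply, Matrix.vecMulVec_apply]
  set c : ℂ := Complex.I / (2 * (Real.pi : ℂ)) with hc
  set D : Matrix (Fin n) (Fin n) (EvenForms V) :=
    P.conjTranspose.map (algebraMap ℂ (EvenForms V)) * A *
      P.map (algebraMap ℂ (EvenForms V)) with hD
  -- The identity det(1 + XY) = det(1 + YX) with X = P moves P to the other side, giving the
  -- congruence PᴴAP.
  have hdet : (1 + c • (H.map (algebraMap ℂ (EvenForms V)) * A)).det = (1 + c • D).det := by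
    rw [hP, Matrix.map_mul, Matrix.mul_assoc, ← Matrix.mul_smul, Matrix.det_one_add_mul_comm,
      Matrix.smul_mul]
  rw [hdet]
  rcases hA with hA | hA
  · refine isSumOfSquaresForm_decompose_det_one_add
      (fun t r => ∑ l, (starRingEnd ℂ) (P l r) • β t l)
      (fun t r => Submodule.sum_mem _ fun l _ => Submodule.smul_mem _ _ (hβ t l)) D ?_ k
    intro r s
    rw [hD, coe_conjTranspose_mul_mul, ← sum_smul_mul_conj]
    simp only [hA, Complex.conj_conj]
  · have htr : (1 + c • D).det = (1 + c • D.transpose).det := by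
      rw [← Matrix.det_transpose, Matrix.transpose_add, Matrix.transpose_one,
        Matrix.transpose_smul]
    rw [htr]
    -- After transposition the entries of Pᴴ fall on the conjugated factor, so the new columns use P
    -- itself instead of its conjugate.
    refine isSumOfSquaresForm_decompose_det_one_add
      (fun t r => ∑ l, P l r • β t l)
      (fun t r => Submodule.sum_mem _ fun l _ => Submodule.smul_mem _ _ (hβ t l)) _ ?_ k
    intro r s
    rw [Matrix.transpose_apply, hD, coe_conjTranspose_mul_mul, ← sum_smul_mul_conj,
      Finset.sum_comm]
    simp only [hA, mul_comm]

end Algebra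

/-! ### The Gram matrix, the curvature and the Chern forms at a point -/

namespace HermitianMetric

variable {V : Type*} [NormedAddCommGroup V] [NormedSpace ℂ V]
  {X : Type*} [TopologicalSpace X] [ChartedSpace V X]
  {m : ℕ} {E : X → Type*} [TopologicalSpace (Bundle.TotalSpace (Fin m → ℂ) E)]
  [∀ x, AddCommGroup (E x)] [∀ x, Module ℂ (E x)] [∀ x, TopologicalSpace (E x)]
  [FiberBundle (Fin m → ℂ) E]

theorem contDiffAt_gram (h : HermitianMetric V m E) (x : X) (j k : Fin m) :
    ContDiffAt ℝ 2 (fun z => h.gram x z j k) (chartAt V x x) := by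
  have h1 := (h.smooth (trivializationAt (Fin m → ℂ) E x) (Pi.single j 1)
    (Pi.single k 1)).contMDiffAt ((trivializationAt (Fin m → ℂ) E x).open_baseSet.mem_nhds
      (FiberBundle.mem_baseSet_trivializationAt' x))
  have h2 := (contMDiffAt_iff.1 h1).2
  simp only [mfld_simps, contDiffWithinAt_univ] at h2
  exact h2.of_le (WithTop.coe_le_coe.2 (le_top : (2 : ℕ∞) ≤ ⊤))

theorem posDef_gram [VectorBundle ℂ (Fin m → ℂ) E] (h : HermitianMetric V m E) (x : X) :
    (h.gram x (chartAt V x x)).PosDef := by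
  let t := trivializationAt (Fin m → ℂ) E x
  have hx : x ∈ t.baseSet := FiberBundle.mem_baseSet_trivializationAt' x
  let L : (Fin m → ℂ) ≃ₗ[ℂ] E x := (t.linearEquivAt ℂ x hx).symm
  have hG : ∀ j k, h.gram x (chartAt V x x) j k
      = h.inner x (L (Pi.single j 1)) (L (Pi.single k 1)) := by
    intro j k
    -- The base point occurs in the type of the fibre, so the point given by the chart is replaced
    -- by a variable before being identified with x.
    have key : ∀ y, y = x → h.inner y (t.symm y (Pi.single j 1)) (t.symm y (Pi.single k 1))
        = h.inner x (L (Pi.single j 1)) (L (Pi.single k 1)) := by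
      rintro y rfl
      rfl
    exact key _ ((chartAt V x).left_inv (mem_chart_source V x))
  have hquad : ∀ a : Fin m → ℂ, star a ⬝ᵥ (h.gram x (chartAt V x x)).mulVec a
      = h.inner x (L a) (L a) := by
    intro a
    have ha : L a = ∑ j, a j • L (Pi.single j 1) := by
      conv_lhs => rw [pi_eq_sum_univ' a]
      simp [map_sum]
    rw [ha]
    simp only [map_sum, LinearMap.sum_apply, map_smulₛₗ, LinearMap.smul_apply,
      dotProduct, Matrix.mulVec, hG, Finset.mul_sum, smul_eq_mul, Pi.star_apply]
    rw [Finset.sum_comm]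
    refine Finset.sum_congr rfl fun j _ => Finset.sum_congr rfl fun l _ => ?_
    simp only [RCLike.star_def, RingHom.id_apply]
    ring
  refine Matrix.PosDef.of_dotProduct_mulVec_pos ?_ fun a ha => ?_
  · ext j k
    rw [Matrix.conjTranspose_apply, hG, hG, RCLike.star_def, h.conj_symm]
  · rw [hquad]
    exact h.pos x _ (by simpa using ha)

variable [FiniteDimensional ℂ V]

/-- The curvature matrix with the first index lowered by the metric. -/
def loweredCurvature (h : HermitianMetric V m E) (x : X) : Matrix (Fin m) (Fin m) (Forms V) :=
  Matrix.of fun j k => ∑ l, h.gram x (chartAt V x x) j l • h.curvature x l k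

/-- Testing on frame vectors is enough, since every tensor can be written as ∑ v_s ⊗ e_s with one
tangent vector for each frame vector. -/
theorem curvaturePairing_single (h : HermitianMetric V m E) (x : X) (v w : V) (s t : Fin m) :
    h.curvaturePairing x v w (Pi.single s 1) (Pi.single t 1)
      = evalForm (h.loweredCurvature x s t) v w := by
  rw [loweredCurvature, Matrix.of_apply, evalForm_sum_smul, curvaturePairing,
    Matrix.mulVec_single_one, Pi.star_single, star_one, single_one_dotProduct]
  rfl

theorem loweredCurvature_mem [VectorBundle ℂ (Fin m → ℂ) E] (h : HermitianMetric V m E) (x : X)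
    (j k : Fin m) : h.loweredCurvature x j k ∈ bidegree V 1 1 :=
  sum_gram_smul_curvature_mem (contDiffAt_gram h x) (h.posDef_gram x).det_pos.ne'
    (fun _ _ _ => rfl) j k

theorem curvature_eq [VectorBundle ℂ (Fin m → ℂ) E] (h : HermitianMetric V m E) (x : X)
    (j k : Fin m) : h.curvature x j k
      = ∑ l, (h.gram x (chartAt V x x))⁻¹ j l • h.loweredCurvature x l k := by
  have h1 : (h.gram x (chartAt V x x))⁻¹ * h.gram x (chartAt V x x) = 1 :=
    Matrix.nonsing_inv_mul _ (isUnit_iff_ne_zero.2 (h.posDef_gram x).det_pos.ne')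
  simp only [loweredCurvature, Matrix.of_apply, Finset.smul_sum, smul_smul]
  rw [Finset.sum_comm]
  simp only [← Finset.sum_smul, ← Matrix.mul_apply, h1]
  simp [Matrix.one_apply]

theorem isSumOfSquaresForm_chernForm [VectorBundle ℂ (Fin m → ℂ) E] (h : HermitianMetric V m E)
    (hE : h.IsBottChernPositive ∨ h.IsNakanoPositive) (k : ℕ) (x : X) :
    IsSumOfSquaresForm k (h.chernForm k x) := by
  let A : Matrix (Fin m) (Fin m) (EvenForms V) := Matrix.of fun i j =>
    ⟨h.loweredCurvature x i j, bidegree_one_one_le_evenForms (h.loweredCurvature_mem x i j)⟩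
  have hc : h.totalChernForm x = (((1 + (Complex.I / (2 * (Real.pi : ℂ))) •
      ((h.gram x (chartAt V x x))⁻¹.map (algebraMap ℂ (EvenForms V)) * A)).det :
        EvenForms V) : Forms V) := by
    rw [coe_det_evenForms _ (Equiv.refl _), totalChernForm]
    have hentry : ∀ i j, ((Complex.I / (2 * (Real.pi : ℂ))) • h.curvature x + 1) i j
        = (((1 + (Complex.I / (2 * (Real.pi : ℂ))) •
      ((h.gram x (chartAt V x x))⁻¹.map (algebraMap ℂ (EvenForms V)) * A)) i j :
        EvenForms V) : Forms V) := by
      intro i j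
      have h1 : (((h.gram x (chartAt V x x))⁻¹.map (algebraMap ℂ (EvenForms V)) * A) i j :
          EvenForms V) = h.curvature x i j := by
        rw [curvature_eq, Matrix.mul_apply, AddSubmonoidClass.coe_finsetSum]
        refine Finset.sum_congr rfl fun l _ => ?_
        rw [Matrix.map_apply, ← Algebra.smul_def]
        rfl
      rw [add_comm, Matrix.add_apply, Matrix.add_apply, Matrix.smul_apply, Matrix.smul_apply, ← h1]
      by_cases hij : i = j
      · subst hij
        simp only [Matrix.one_apply_eq]
        rfl
      · simp only [Matrix.one_apply_ne hij]
        rfl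
    simp only [hentry]
    rfl
  have hβ : ∃ (N : ℕ) (β : Fin N → Fin m → Covector V), (∀ r i, β r i ∈ covectors10 V) ∧
      ((∀ i j, (A i j : Forms V) = ∑ r, oneForm (β r i) * oneForm (conjCovector (β r j))) ∨
      (∀ i j, (A i j : Forms V) = ∑ r, oneForm (β r j) * oneForm (conjCovector (β r i)))) := by
    rcases hE with hE | hE
    · obtain ⟨N, β, hβ, hA⟩ := exists_eq_sum_mul_conj (h.loweredCurvature x)
        (h.loweredCurvature_mem x) fun v => by
          simpa only [curvaturePairing_single] using hE x m v fun s => Pi.single s 1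
      exact ⟨N, β, hβ, Or.inl hA⟩
    -- Nakano positivity pairs `v s` with the second index of the lowered curvature, so it is the
    -- transpose that decomposes.
    · obtain ⟨N, β, hβ, hA⟩ := exists_eq_sum_mul_conj (h.loweredCurvature x).transpose
        (fun i j => h.loweredCurvature_mem x j i) fun v => by
          simpa only [curvaturePairing_single, Matrix.transpose_apply] using hE x m v fun s => Pi.single s 1
      exact ⟨N, β, hβ, Or.inr fun i j => hA j i⟩
  obtain ⟨N, β, hβ, hA⟩ := hβ
  rw [chernForm, hc]
  exact isSumOfSquaresForm_decompose_det_one_add_mul (h.posDef_gram x).inv.posSemidef A β hβ hA k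

end HermitianMetric

end ChernForms

end

theorem proposition7p4
    {V : Type*} [NormedAddCommGroup V] [NormedSpace ℂ V] [FiniteDimensional ℂ V]
    {X : Type*} [TopologicalSpace X] [ChartedSpace V X] [IsManifold 𝓘(ℂ, V) ω X]
    {m : ℕ} {E : X → Type*} [TopologicalSpace (Bundle.TotalSpace (Fin m → ℂ) E)]
    [∀ x, AddCommGroup (E x)] [∀ x, Module ℂ (E x)] [∀ x, TopologicalSpace (E x)]
    [FiberBundle (Fin m → ℂ) E] [VectorBundle ℂ (Fin m → ℂ) E]
    [ContMDiffVectorBundle ω (Fin m → ℂ) E 𝓘(ℂ, V)]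
    (h : HermitianMetric V m E) (hE : h.IsBottChernPositive ∨ h.IsNakanoPositive)
    (k : ℕ) (x : X) :
    IsPositiveForm k (h.chernForm k x) ∧ IsSumOfSquaresForm k (h.chernForm k x) :=
  have hs := h.isSumOfSquaresForm_chernForm hE k x
  ⟨hs.isPositiveForm, hs⟩
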